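/- **Theorem (Existence of an infinite-horizon Berk–Nash solution).** Let $X$ and $A$ be nonempty finite sets (states and actions), $P(\cdot\mid x,a)\in\Delta(X)$ for $(x,a)\in X\times A$ the true transition kernel, $r:X\times A\to\mathbb R$ a reward function, $\beta\in(0,1)$, $\Theta\subset\mathbb R^k$ a nonempty compact convex set, and $Q_\theta(\cdot\mid x,a)\in\Delta(X)$, $\theta\in\Theta$, a family of subjective transition kernels such that $\theta\mapsto Q_\theta(x'\mid x,a)$ is continuous on $\Theta$ for all $x,a,x'$. Let $\Sigma=\Delta(A)^X$ be the set of stationary randomized policies, with the product topology. For $\pi\in\Sigma$ and $\theta\in\Theta$ let $$V_\theta^\pi(x)=\mathbb E^{\pi}_{Q_\theta}\Big[\sum_{t=0}^\infty\beta^t r(x_t,a_t)\,\Big|\,x_0=x\Big],\qquad V_\theta(x)=\sup_{\pi\in\Sigma}V_\theta^\pi(x),$$ where $a_t\sim\pi(\cdot\mid x_t)$ and $x_{t+1}\sim Q_\theta(\cdot\mid x_t,a_t)$, and let $BR(\theta)$ be the set of all $\pi\in\Sigma$ such that, for all $x$ and $a$, $$\pi(a\mid x)>0\ \Rightarrow\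 a\in\arg\max_{b\in A}\Big\{r(x,b)+\beta\sum_{x'}Q_\theta(x'\mid x,b)V_\theta(x')\Big\}.$$ Assume that for every $\pi\in\Sigma$ the Markov chain on $X$ with transition probabilities $P_\pi(x'\mid x)=\sum_a\pi(a\mid x)P(x'\mid x,a)$ is irreducible and aperiodic, let $\mu_\pi$ be its unique stationary distribution, and assume that $\pi\mapsto\mu_\pi$ is continuous from $\Sigma$ to $\Delta(X)$. Assume further that $P(\cdot\mid x,a)\ll Q_\theta(\cdot\mid x,a)$ for all $x,a$ and all $\theta\in\Theta$, and that the long-run Kullback–Leibler divergence $$D(\theta\mid\pi)=\sum_{x}\sum_{a}\mu_\pi(x)\,\pi(a\mid x)\sum_{x'}P(x'\mid x,a)\log\frac{P(x'\mid x,a)}{Q_\theta(x'\mid x,a)}$$ (which is then finite; terms with $P(x'\mid x,a)=0$ are $0$) is jointly continuous in $(\theta,\pi)\in\Theta\times\Sigma$ and convex in $\theta$ for each fixed $\pi$. Let $\Theta^\ast(\pi)=\arg\min_{\theta\in\Theta}D(\theta\mid\pi)$. Then there exists a pair $(\pi^\ast,\theta^\ast)\in\Sigma\times\Theta$ with $$\pi^\ast\in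 BR(\theta^\ast)\quad\text{and}\quad\theta^\ast\in\Theta^\ast(\pi^\ast).$$ -/

import Mathlib

open MeasureTheory ProbabilityTheory

noncomputable section

namespace BerkNash

variable {X A : Type*} [Fintype X] [Fintype A]

/-- Stationary randomized policies `Σ = Δ(A)^X`, with the product topology;
`π x a` is the probability `π(a ∣ x)`. -/
abbrev Policy (X A : Type*) [Fintype A] := X → stdSimplex ℝ A

/-- Controlled transition kernels; `K x a x'` is the probability `K(x' ∣ x, a)`. -/
abbrev TransitionKernel (X A : Type*) [Fintype X] := X → A → stdSimplex ℝ X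

/-! ### The controlled process and its discounted value -/

/-- A state together with the action taken in it, with the discrete σ-algebra. -/
structure StateAction (X A : Type*) where
  /-- the state `x_t` -/
  state : X
  /-- the action `a_t` -/
  action : A

/-- Every set of state-action pairs is measurable. -/
instance (X A : Type*) : MeasurableSpace (StateAction X A) := ⊤

instance (X A : Type*) : DiscreteMeasurableSpace (StateAction X A) := ⟨fun _ => trivial⟩

/-- The probability measure on state-action pairs under which the state has distribution `ν` and,
given the state `x`, the action has distribution `π(· ∣ x)`. -/
def pairMeasure (π : Policy X A) (ν : stdSimplex ℝ X) : Measure (StateAction X A) :=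
  ∑ x, ∑ a, ENNReal.ofReal (ν x * π x a) • Measure.dirac (StateAction.mk x a)

instance (π : Policy X A) (ν : stdSimplex ℝ X) : IsProbabilityMeasure (pairMeasure π ν) where
  measure_univ := by
    have h0 : ∀ x a, 0 ≤ ν x * π x a := fun x a => mul_nonneg (ν.2.1 x) ((π x).2.1 a)
    have h1 : ∀ x, ∑ a, π x a = 1 := fun x => (π x).2.2
    have h2 : ∑ x, ν x = 1 := ν.2.2
    simp only [pairMeasure, Measure.coe_finsetSum, Finset.sum_apply, Measure.smul_apply,
      measure_univ, smul_eq_mul, mul_one]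
    simp_rw [← ENNReal.ofReal_sum_of_nonneg (fun a _ => h0 _ a)]
    rw [← ENNReal.ofReal_sum_of_nonneg
      (fun x _ => Finset.sum_nonneg fun a _ => h0 x a)]
    simp_rw [← Finset.mul_sum, h1, mul_one, h2, ENNReal.ofReal_one]

/-- The law of `(x_{t+1}, a_{t+1})` given the history up to time `t`:
`x_{t+1} ∼ K(· ∣ x_t, a_t)` and `a_{t+1} ∼ π(· ∣ x_{t+1})`. -/
def stepKernel (K : TransitionKernel X A) (π : Policy X A) (t : ℕ) :
    Kernel (Π _ : Finset.Iic t, StateAction X A) (StateAction X A) where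
  toFun h :=
    pairMeasure π (K (h ⟨t, Finset.mem_Iic.2 le_rfl⟩).state (h ⟨t, Finset.mem_Iic.2 le_rfl⟩).action)
  measurable' :=
    (Measurable.of_discrete
      (f := fun s : StateAction X A => pairMeasure π (K s.state s.action))).comp
      (measurable_pi_apply _)

instance (K : TransitionKernel X A) (π : Policy X A) (t : ℕ) :
    IsMarkovKernel (stepKernel K π t) :=
  ⟨fun _ => inferInstanceAs (IsProbabilityMeasure (pairMeasure π _))⟩

/-- The law of `(x_0, a_0)` when `x_0 = x` and `a_0 ∼ π(· ∣ x)`. -/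
def initialMeasure (π : Policy X A) (x : X) : Measure (StateAction X A) :=
  ∑ a, ENNReal.ofReal (π x a) • Measure.dirac (StateAction.mk x a)

instance (π : Policy X A) (x : X) : IsProbabilityMeasure (initialMeasure π x) where
  measure_univ := by
    have h0 : ∀ a, 0 ≤ π x a := (π x).2.1
    have h1 : ∑ a, π x a = 1 := (π x).2.2
    simp only [initialMeasure, Measure.coe_finsetSum, Finset.sum_apply, Measure.smul_apply,
      measure_univ, smul_eq_mul, mul_one]
    rw [← ENNReal.ofReal_sum_of_nonneg (fun a _ => h0 a), h1, ENNReal.ofReal_one]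

/-- The law, on the space of all trajectories `((x_0, a_0), (x_1, a_1), …)`, of the process
controlled by the policy `π`, with transition kernel `K` and initial state `x`. -/
def processLaw (K : TransitionKernel X A) (π : Policy X A) (x : X) :
    Measure (ℕ → StateAction X A) :=
  Kernel.trajMeasure (X := fun _ => StateAction X A) (initialMeasure π x) (stepKernel K π)

/-- The discounted value `E[∑_t β^t r(x_t, a_t) ∣ x_0 = x]` of the policy `π` under the
transition kernel `K`. -/
def value (K : TransitionKernel X A) (r : X → A → ℝ) (β : ℝ) (π : Policy X A) (x : X) : ℝ :=
  ∫ ω, ∑' t : ℕ, β ^ t * r (ω t).state (ω t).action ∂(processLaw K π x)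

/-- The optimal value `V(x) = sup_π V^π(x)` under the transition kernel `K`. -/
def optimalValue (K : TransitionKernel X A) (r : X → A → ℝ) (β : ℝ) (x : X) : ℝ :=
  ⨆ π : Policy X A, value K r β π x

/-! ### Subjective optimality -/

/-- `r(x, a) + β ∑_{x'} K(x' ∣ x, a) V(x')`, with `V` the optimal value function. -/
def actionValue (K : TransitionKernel X A) (r : X → A → ℝ) (β : ℝ) (x : X) (a : A) : ℝ :=
  r x a + β * ∑ x', K x a x' * optimalValue K r β x'

/-- The best-response correspondence `BR(θ)` of the subjective models `Q_θ`: policies that put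
positive probability only on actions that maximize the action value. -/
def bestResponse {T : Type*} (Q : T → TransitionKernel X A) (r : X → A → ℝ) (β : ℝ) (θ : T) :
    Set (Policy X A) :=
  {π | ∀ x a, 0 < π x a → ∀ b, actionValue (Q θ) r β x b ≤ actionValue (Q θ) r β x a}

/-! ### Long-run statistical consistency -/

/-- The Markov transition matrix `P_π(x' ∣ x) = ∑_a π(a ∣ x) P(x' ∣ x, a)`
(row `x`, column `x'`). -/
def inducedMatrix (P : TransitionKernel X A) (π : Policy X A) : Matrix X X ℝ :=
  Matrix.of fun x x' => ∑ a, π x a * P x a x'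

/-- Every state of the Markov chain has period one: `1` is the only common divisor of the
possible return times `n ≥ 1`. -/
def IsAperiodic [DecidableEq X] (M : Matrix X X ℝ) : Prop :=
  ∀ x, ∀ d : ℕ, (∀ n : ℕ, 1 ≤ n → 0 < (M ^ n) x x → d ∣ n) → d = 1

/-- `μ` is a stationary distribution of the true process under `π`. -/
def IsStationary (P : TransitionKernel X A) (π : Policy X A) (μ : stdSimplex ℝ X) : Prop :=
  ∀ x', μ x' = ∑ x, ∑ a, μ x * π x a * P x a x'

/-- The stationary distribution `μ_π`. It is meaningful as soon as `inducedMatrix P π` is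
irreducible, since there is then exactly one stationary distribution. -/
def stationaryDist [Nonempty X] (P : TransitionKernel X A) (π : Policy X A) : stdSimplex ℝ X :=
  Classical.epsilon (IsStationary P π)

/-- The Kullback-Leibler divergence of `ν` from `μ`, for `ν ≪ μ`
(terms with `ν x' = 0` vanish). -/
def klDivergence (ν μ : stdSimplex ℝ X) : ℝ :=
  ∑ x', ν x' * Real.log (ν x' / μ x')

/-- The long-run Kullback-Leibler divergence `D(θ ∣ π)`. -/
def longRunKL [Nonempty X] {T : Type*} (P : TransitionKernel X A) (Q : T → TransitionKernel X A)
    (θ : T) (π : Policy X A) : ℝ :=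
  ∑ x, ∑ a, stationaryDist P π x * π x a * klDivergence (P x a) (Q θ x a)

/-- The pseudo-true parameters `Θ^*(π) = argmin_{θ ∈ Θ} D(θ ∣ π)`. -/
def pseudoTrue [Nonempty X] {T : Type*} (P : TransitionKernel X A) (Q : T → TransitionKernel X A)
    (Θ : Set T) (π : Policy X A) : Set T :=
  {θ | θ ∈ Θ ∧ ∀ θ' ∈ Θ, longRunKL P Q θ π ≤ longRunKL P Q θ' π}

/-- Infinite-horizon Berk-Nash solutions: `π ∈ BR(θ)` and `θ ∈ Θ^*(π)`. -/
structure IsSolution [Nonempty X] {T : Type*} (P : TransitionKernel X A)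
    (Q : T → TransitionKernel X A) (Θ : Set T) (r : X → A → ℝ) (β : ℝ)
    (π : Policy X A) (θ : T) : Prop where
  subjective_optimality : π ∈ bestResponse Q r β θ
  statistical_consistency : θ ∈ pseudoTrue P Q Θ π

end BerkNash

end

/-! A solution is an equilibrium of a two-player game. The agent chooses `π` to maximize the sum
over `x, a` of `π x a * q θ x a`, where `q θ` is the action value under `Q θ`; the opponent chooses
`θ` to minimize `D(θ ∣ π)`. Since `q θ` contains the optimal value, which does not depend on `π`,
the first payoff is linear in `π`. A maximizer lies in `BR(θ)` because mass can be moved within a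
single state (`le_of_totalValue_le`); no Bellman equation is needed.

For `z = (π, θ)` and `y = (π', θ')` let `f z y` be the total gain of the two players from deviating
from `z` to `y`. An equilibrium is a `z` with `f z y ≤ 0` for all `y`. Ky Fan's inequality
(`exists_forall_le_zero_of_mixtures`) provides it: linearity and Jensen bound the weighted gains at
a mixture by zero, and `continuous_actionValue` gives continuity in `z`.

Ky Fan's inequality is reduced by compactness to a closed cover of a simplex
(`stdSimplex.exists_mem_of_pos`), which is the limit of a colouring result on finer and finer grids,
proved by Scarf's parity argument. -/

/-! ### Scarf's combinatorial lemma -/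

namespace Scarf

open Finset

variable {ι V α : Type*} [LinearOrder α]

/-- A finite set `S` is dominant for the family of rankings `u` if no element ranks strictly above
the minimum of `S` in all of them. -/
def IsDominant (u : ι → V → α) (S : Finset V) : Prop :=
  ∀ y, ∃ i, ∀ x ∈ S, u i y ≤ u i x

theorem IsDominant.mono {u : ι → V → α} {S T : Finset V} (hT : IsDominant u T) (h : S ⊆ T) :
    IsDominant u S := fun y => (hT y).imp fun _ hi x hx => hi x (h hx)

/-- The elements that exceed the minimum of `S` in every ranking except possibly the `k`-th. -/
def above (u : ι → V → α) (S : Finset V) (k : ι) : Set V :=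
  {y | ∀ l, l ≠ k → ∃ z ∈ S, u l z < u l y}

/-- The `k`-th-ranked greatest elements of `above u S k`. -/
def topAbove (u : ι → V → α) (S : Finset V) (k : ι) : Set V :=
  {x | x ∈ above u S k ∧ ∀ y ∈ above u S k, u k y ≤ u k x}

theorem exists_mem_topAbove [Finite V] (u : ι → V → α) (S : Finset V) (k : ι)
    (h : (above u S k).Nonempty) : ∃ x, x ∈ topAbove u S k := by
  obtain ⟨x, hx, hmax⟩ := Set.exists_max_image _ (u k) (Set.toFinite (above u S k)) h
  exact ⟨x, hx, hmax⟩

theorem IsDominant.le_of_mem_above {u : ι → V → α} {S : Finset V} (hS : IsDominant u S)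
    {k : ι} {x : V} (hx : x ∈ above u S k) : ∀ z ∈ S, u k x ≤ u k z := by
  obtain ⟨l, hl⟩ := hS x
  by_cases hlk : l = k
  · exact hlk ▸ hl
  · obtain ⟨z, hz, hlt⟩ := hx l hlk
    exact absurd (hl z hz) (not_le.2 hlt)

theorem exists_argmin (u : ι → V → α) {S : Finset V} (hS : S.Nonempty) :
    ∃ m : ι → V, (∀ k, m k ∈ S) ∧ ∀ k, ∀ z ∈ S, u k (m k) ≤ u k z := by
  choose m hm hmin using fun k => S.exists_min_image (u k) hS
  exact ⟨m, hm, hmin⟩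

/-- Dominance is applied to the member `x` itself. Hence the argmin map is onto `S`: a bijection
when `S` has as many elements as there are rankings, and with a single coincidence when it has one
fewer. -/
theorem IsDominant.exists_argmin_eq {u : ι → V → α} (hu : ∀ i, Function.Injective (u i))
    {S : Finset V} (hS : IsDominant u S) {m : ι → V} (hm : ∀ k, m k ∈ S)
    (hmin : ∀ k, ∀ z ∈ S, u k (m k) ≤ u k z) {x : V} (hx : x ∈ S) : ∃ k, m k = x := by
  obtain ⟨k, hk⟩ := hS x
  exact ⟨k, hu k (le_antisymm (hmin k x hx) (hk _ (hm k)))⟩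

theorem IsDominant.argmin_injective [Fintype ι] {u : ι → V → α} (hu : ∀ i, Function.Injective (u i))
    {S : Finset V} (hS : IsDominant u S) (hcard : #S = Fintype.card ι) {m : ι → V}
    (hm : ∀ k, m k ∈ S) (hmin : ∀ k, ∀ z ∈ S, u k (m k) ≤ u k z) : Function.Injective m := by
  classical
  have himage : univ.image m = S := by
    ext x
    simp only [mem_image, mem_univ, true_and]
    exact ⟨by rintro ⟨k, rfl⟩; exact hm k, fun hx => hS.exists_argmin_eq hu hm hmin hx⟩
  have hinj : Set.InjOn m (univ : Finset ι) := card_image_iff.1 (by rw [himage, hcard, card_univ])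
  rwa [coe_univ, Set.injOn_univ] at hinj

/-- A nonempty dominant set with one element less than there are rankings has exactly two
rankings with the same minimum. -/
theorem IsDominant.exists_pair [Fintype ι] {u : ι → V → α} (hu : ∀ i, Function.Injective (u i))
    {S : Finset V} (hS : IsDominant u S) (hcard : #S + 1 = Fintype.card ι) {m : ι → V}
    (hm : ∀ k, m k ∈ S) (hmin : ∀ k, ∀ z ∈ S, u k (m k) ≤ u k z) :
    ∃ i j, i ≠ j ∧ m i = m j ∧ ∀ k, (k = i ∨ k = j) → ∀ x ∈ S, ∃ l, l ≠ k ∧ m l = x := by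
  obtain ⟨i, -, j, -, hij, hmij⟩ := exists_ne_map_eq_of_card_lt_of_maps_to
    (s := (univ : Finset ι)) (t := S) (f := m) (by rw [card_univ]; omega) (fun k _ => hm k)
  refine ⟨i, j, hij, hmij, fun k hk x hx => ?_⟩
  obtain ⟨l, hl⟩ := hS.exists_argmin_eq hu hm hmin hx
  by_cases hlk : l = k
  · rcases hk with rfl | rfl
    · exact ⟨j, hij.symm, by rw [← hmij, ← hlk, hl]⟩
    · exact ⟨i, hij, by rw [hmij, ← hlk, hl]⟩
  · exact ⟨l, hlk, hl⟩

variable [DecidableEq V]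

/-- A pivot step: the ranking `k` can be released because every element of `S` is still the minimum
in another ranking, and `x` takes over as the minimum in `k`. -/
theorem isDominant_insert_of_mem_topAbove {u : ι → V → α}
    {S : Finset V} (hS : IsDominant u S) {m : ι → V}
    (hmin : ∀ k, ∀ z ∈ S, u k (m k) ≤ u k z) {k : ι} (hk : ∀ x ∈ S, ∃ l, l ≠ k ∧ m l = x)
    {x : V} (hx : x ∈ topAbove u S k) : x ∉ S ∧ IsDominant u (insert x S) := by
  refine ⟨fun hxS => ?_, fun y => ?_⟩
  · obtain ⟨l, hlk, rfl⟩ := hk x hxS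
    obtain ⟨z, hz, hlt⟩ := hx.1 l hlk
    exact absurd (hmin l z hz) (not_le.2 hlt)
  · by_cases hy : y ∈ above u S k
    · refine ⟨k, fun z hz => ?_⟩
      rcases mem_insert.1 hz with rfl | hz
      · exact hx.2 y hy
      · exact (hx.2 y hy).trans (hS.le_of_mem_above hx.1 z hz)
    · simp only [above, Set.mem_ofPred_eq, not_forall, not_exists, not_and, not_lt] at hy
      obtain ⟨l, hlk, hl⟩ := hy
      refine ⟨l, fun z hz => ?_⟩
      rcases mem_insert.1 hz with rfl | hz
      · obtain ⟨w, hw, hlt⟩ := hx.1 l hlk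
        exact (hl w hw).trans hlt.le
      · exact hl z hz

/-- In the enlarged set `x` is the minimum for exactly one ranking `k`, and all other minima are
unchanged. If `k` were neither `i` nor `j`, the coincidence `m i = m j` would survive, although the
new argmin map is injective. -/
theorem exists_mem_topAbove_of_isDominant_insert [Fintype ι] {u : ι → V → α}
    (hu : ∀ i, Function.Injective (u i)) {S : Finset V} (hcard : #S + 1 = Fintype.card ι)
    {m : ι → V} (hm : ∀ k, m k ∈ S) (hmin : ∀ k, ∀ z ∈ S, u k (m k) ≤ u k z) {i j : ι}
    (hij : i ≠ j) (hmij : m i = m j) {x : V} (hxS : x ∉ S) (hx : IsDominant u (insert x S)) :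
    x ∈ topAbove u S i ∪ topAbove u S j := by
  have hcard' : #(insert x S) = Fintype.card ι := by rw [card_insert_of_notMem hxS, hcard]
  obtain ⟨m', hm', hmin'⟩ := exists_argmin u (insert_nonempty x S)
  have hinj := hx.argmin_injective hu hcard' hm' hmin'
  obtain ⟨k, hk⟩ := hx.exists_argmin_eq hu hm' hmin' (mem_insert_self x S)
  have hne : ∀ l, l ≠ k → m' l ≠ x := fun l hl h => hl (hinj (h.trans hk.symm))
  have heq : ∀ l, l ≠ k → m' l = m l := fun l hl => hu l <| le_antisymm
    (hmin' l _ (mem_insert_of_mem (hm l)))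
    (hmin l _ ((mem_insert.1 (hm' l)).resolve_left (hne l hl)))
  have habove : x ∈ above u S k := fun l hl => ⟨m l, hm l, lt_of_le_of_ne
    (heq l hl ▸ hmin' l x (mem_insert_self x S)) fun h => hne l hl ((heq l hl).trans (hu l h))⟩
  have htop : x ∈ topAbove u S k := by
    refine ⟨habove, fun y hy => ?_⟩
    obtain ⟨l, hl⟩ := hx y
    by_cases hlk : l = k
    · exact hlk ▸ hl x (mem_insert_self x S)
    · obtain ⟨z, hz, hlt⟩ := hy l hlk
      exact absurd (hl z (mem_insert_of_mem hz)) (not_le.2 hlt)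
  by_cases hik : i = k
  · exact Or.inl (hik ▸ htop)
  by_cases hjk : j = k
  · exact Or.inr (hjk ▸ htop)
  · exact absurd (hinj (by rw [heq i hik, heq j hjk, hmij])) hij

open Classical in
/-- The elements whose insertion into `S` keeps it dominant. -/
noncomputable def extensions [Fintype V] (u : ι → V → α) (S : Finset V) : Finset V :=
  {x | x ∉ S ∧ IsDominant u (insert x S)}

/-- One extension arises from releasing each of the two rankings that share a minimum. -/
theorem card_extensions_eq_two [Fintype ι] [Fintype V] {u : ι → V → α}
    (hu : ∀ i, Function.Injective (u i))
    {S : Finset V} (hne : S.Nonempty) (hS : IsDominant u S) (hcard : #S + 1 = Fintype.card ι)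
    (habove : ∀ k, (above u S k).Nonempty) : #(extensions u S) = 2 := by
  obtain ⟨m, hm, hmin⟩ := exists_argmin u hne
  obtain ⟨i, j, hij, hmij, hk⟩ := hS.exists_pair hu hcard hm hmin
  obtain ⟨x, hx⟩ := exists_mem_topAbove u S i (habove i)
  obtain ⟨y, hy⟩ := exists_mem_topAbove u S j (habove j)
  have huniq : ∀ k z w, z ∈ topAbove u S k → w ∈ topAbove u S k → z = w := fun k z w hz hw =>
    hu k (le_antisymm (hw.2 z hz.1) (hz.2 w hw.1))
  have hxy : x ≠ y := by
    rintro rfl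
    obtain ⟨z, hz, hlt⟩ := hy.1 i hij
    exact absurd (hS.le_of_mem_above hx.1 z hz) (not_le.2 hlt)
  rw [card_eq_two]
  refine ⟨x, y, hxy, ?_⟩
  ext z
  simp only [extensions, mem_filter, mem_univ, true_and, mem_insert, mem_singleton]
  constructor
  · rintro ⟨hzS, hz⟩
    rcases exists_mem_topAbove_of_isDominant_insert hu hcard hm hmin hij hmij hzS hz with h | h
    · exact Or.inl (huniq i _ _ h hx)
    · exact Or.inr (huniq j _ _ h hy)
  · rintro (rfl | rfl)
    · exact isDominant_insert_of_mem_topAbove hS hmin (hk i (Or.inl rfl)) hx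
    · exact isDominant_insert_of_mem_topAbove hS hmin (hk j (Or.inr rfl)) hy

variable [Fintype ι] [DecidableEq ι]

/-- Removing one element from a set that does not carry all the colours leaves all the colours but
`l` for an even number of choices of that element. -/
theorem even_card_erase_image_eq {c : V → ι} {S : Finset V} (hcard : #S = Fintype.card ι)
    (hc : S.image c ≠ univ) (l : ι) :
    Even #{s ∈ S | (S.erase s).image c = univ.erase l} := by
  have hinj : ∀ s ∈ S, (S.erase s).image c = univ.erase l → Set.InjOn c (S.erase s) := by
    intro s hs h
    rw [← card_image_iff, h, card_erase_of_mem (mem_univ l), card_erase_of_mem hs, hcard, card_univ]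
  rcases Finset.eq_empty_or_nonempty {s ∈ S | (S.erase s).image c = univ.erase l} with h0 | ⟨s, hs⟩
  · simp [h0]
  obtain ⟨hsS, hs⟩ := mem_filter.1 hs
  have himage : S.image c = insert (c s) (univ.erase l) := by
    rw [← hs, ← image_insert, insert_erase hsS]
  have hcs : c s ∈ univ.erase l := by
    refine mem_erase.2 ⟨fun h => hc ?_, mem_univ _⟩
    rw [himage, h, insert_erase (mem_univ l)]
  rw [insert_eq_of_mem hcs] at himage
  obtain ⟨t, ht, htc⟩ := mem_image.1 (hs ▸ hcs)
  obtain ⟨hts, htS⟩ := mem_erase.1 ht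
  -- One colour is missing, so exactly one colour is repeated, by `s` and `t`; only these two can be
  -- removed without losing a colour.
  have : ({s ∈ S | (S.erase s).image c = univ.erase l} : Finset V) = {s, t} := by
    ext w
    simp only [mem_filter, mem_insert, mem_singleton]
    constructor
    · rintro ⟨hw, h⟩
      by_contra! hne
      exact hts (hinj w hw h (mem_erase.2 ⟨hne.2.symm, htS⟩) (mem_erase.2 ⟨hne.1.symm, hsS⟩) htc)
    · rintro (rfl | rfl)
      · exact ⟨hsS, hs⟩
      · refine ⟨htS, himage ▸ subset_antisymm (image_subset_image (erase_subset _ _)) ?_⟩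
        intro k hk
        obtain ⟨v, hv, rfl⟩ := mem_image.1 hk
        by_cases hvw : v = w
        · exact mem_image.2 ⟨s, mem_erase.2 ⟨hts.symm, hsS⟩, by rw [hvw, htc]⟩
        · exact mem_image_of_mem c (mem_erase.2 ⟨hvw, hv⟩)
  rw [this, card_pair hts.symm]
  exact even_two

variable [Fintype V]

/-- The boundary facet of slack elements extends in exactly one way. -/
theorem card_extensions_slack {u : ι → V → α} (hu : ∀ i, Function.Injective (u i)) {e : ι → V}
    (hlow : ∀ i v, v ≠ e i → u i (e i) < u i v)
    (hhigh : ∀ i j v, j ≠ i → v ∉ Set.range e → u i v < u i (e j))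
    (hV : ∃ v, v ∉ Set.range e) (l : ι) :
    #(extensions u ((univ.erase l).image e)) = 1 := by
  -- For `i ≠ l` the element `e i` is the bottom of ranking `i`, so only ranking `l` can witness
  -- dominance over non-slack elements. The extension must therefore be the `u l`-greatest of these.
  obtain ⟨x, hx, hmax⟩ := Set.exists_max_image _ (u l) (Set.toFinite (Set.range e)ᶜ) hV
  have hdom : ∀ z, z ∉ Set.range e → (∀ y, y ∉ Set.range e → u l y ≤ u l z) →
      IsDominant u (insert z ((univ.erase l).image e)) := by
    intro z hz hzmax y
    by_cases hy : y ∈ Set.range e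
    · obtain ⟨i, rfl⟩ := hy
      refine ⟨i, fun w _ => ?_⟩
      by_cases hw : w = e i
      · rw [hw]
      · exact (hlow i w hw).le
    · refine ⟨l, fun w hw => ?_⟩
      rcases mem_insert.1 hw with rfl | hw
      · exact hzmax y hy
      · obtain ⟨k, hk, rfl⟩ := mem_image.1 hw
        exact (hhigh l k y (ne_of_mem_erase hk) hy).le
  rw [card_eq_one]
  refine ⟨x, ?_⟩
  ext z
  simp only [extensions, mem_filter, mem_univ, true_and, mem_singleton]
  constructor
  · rintro ⟨hz, hzdom⟩
    obtain ⟨i, hi⟩ := hzdom x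
    have hil : i = l := by
      by_contra h
      exact absurd (hi (e i) (mem_insert_of_mem (mem_image_of_mem e (mem_erase.2 ⟨h, mem_univ i⟩))))
        (not_le.2 (hlow i x fun h => hx ⟨i, h.symm⟩))
    subst hil
    have hxz := hi z (mem_insert_self _ _)
    by_cases hzr : z ∈ Set.range e
    · obtain ⟨k, rfl⟩ := hzr
      have hk : k = i := by
        by_contra h
        exact hz (mem_image_of_mem e (mem_erase.2 ⟨h, mem_univ k⟩))
      subst hk
      exact absurd hxz (not_le.2 (hlow k x fun h => hx ⟨k, h.symm⟩))
    · exact hu i (le_antisymm (hmax z hzr) hxz)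
  · rintro rfl
    refine ⟨fun h => ?_, hdom z hx hmax⟩
    obtain ⟨k, -, rfl⟩ := mem_image.1 h
    exact hx ⟨k, rfl⟩

/-- **Scarf's lemma**: for every colouring that gives slack elements their own index there is a
dominant set that carries every colour exactly once. -/
theorem exists_colorful [Nontrivial ι] {u : ι → V → α} (hu : ∀ i, Function.Injective (u i))
    {e : ι → V} (hlow : ∀ i v, v ≠ e i → u i (e i) < u i v)
    (hhigh : ∀ i j v, j ≠ i → v ∉ Set.range e → u i v < u i (e j))
    (hV : ∃ v, v ∉ Set.range e) {c : V → ι} (hc : ∀ i, c (e i) = i) :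
    ∃ S : Finset V, IsDominant u S ∧ #S = Fintype.card ι ∧ S.image c = univ := by
  classical
  by_contra! hno
  obtain ⟨l⟩ : Nonempty ι := inferInstance
  have hone : 1 < Fintype.card ι := Fintype.one_lt_card
  -- Incidences of doors and rooms are counted twice. Without a fully coloured room each room has an
  -- even number of doors; each door lies in two rooms, except the slack facet `S₀`, which lies in
  -- one. The parities disagree.
  let rooms : Finset (Finset V) := {S | IsDominant u S ∧ #S = Fintype.card ι}
  let doors : Finset (Finset V) :=
    {S | IsDominant u S ∧ #S + 1 = Fintype.card ι ∧ S.image c = univ.erase l}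
  have hcount := sum_card_bipartiteAbove_eq_sum_card_bipartiteBelow (s := doors) (t := rooms)
    (fun S T => S ⊆ T)
  have hroom : ∀ T ∈ rooms, Even #(doors.bipartiteBelow (fun S T => S ⊆ T) T) := by
    intro T hT
    obtain ⟨hTd, hTc⟩ := (mem_filter.1 hT).2
    have heq : doors.bipartiteBelow (fun S T => S ⊆ T) T =
        ({s ∈ T | (T.erase s).image c = univ.erase l} : Finset V).image T.erase := by
      ext S
      simp only [bipartiteBelow, doors, mem_filter, mem_univ, true_and, mem_image]
      constructor
      · rintro ⟨⟨-, hSc, hSi⟩, hST⟩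
        obtain ⟨s, hs⟩ := card_eq_one.1 (show #(T \ S) = 1 by
          rw [card_sdiff_of_subset hST]; omega)
        have hsT : s ∈ T \ S := hs ▸ mem_singleton_self s
        have hS : T.erase s = S := by
          rw [erase_eq, ← hs, Finset.sdiff_sdiff_eq_self hST]
        exact ⟨s, ⟨(mem_sdiff.1 hsT).1, hS ▸ hSi⟩, hS⟩
      · rintro ⟨s, ⟨hs, hi⟩, rfl⟩
        refine ⟨⟨hTd.mono (erase_subset _ _), ?_, hi⟩, erase_subset _ _⟩
        rw [card_erase_of_mem hs]; omega
    rw [heq, card_image_of_injOn ((erase_injOn T).mono (by simp +contextual [Set.subset_def]))]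
    exact even_card_erase_image_eq hTc (hno T hTd hTc) l
  have hdoorcard : ∀ S ∈ doors,
      #(rooms.bipartiteAbove (fun S T => S ⊆ T) S) = #(extensions u S) := by
    intro S hS
    obtain ⟨hSd, hSc, hSi⟩ := (mem_filter.1 hS).2
    have heq : rooms.bipartiteAbove (fun S T => S ⊆ T) S =
        (extensions u S).image (fun x => insert x S) := by
      ext T
      simp only [bipartiteAbove, rooms, extensions, mem_filter, mem_univ, true_and, mem_image]
      constructor
      · rintro ⟨⟨hTd, hTc⟩, hST⟩
        obtain ⟨s, hs⟩ := card_eq_one.1 (show #(T \ S) = 1 by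
          rw [card_sdiff_of_subset hST]; omega)
        have hsT : s ∈ T \ S := hs ▸ mem_singleton_self s
        have hT : insert s S = T := by
          rw [insert_eq, ← hs, sdiff_union_of_subset hST]
        exact ⟨s, ⟨(mem_sdiff.1 hsT).2, hT ▸ hTd⟩, hT⟩
      · rintro ⟨s, ⟨hs, hd⟩, rfl⟩
        exact ⟨⟨hd, by rw [card_insert_of_notMem hs, hSc]⟩, subset_insert _ _⟩
    rw [heq, card_image_of_injOn]
    intro x hx y _ hxy
    have hx' : x ∈ insert y S := by
      rw [← show insert x S = insert y S from hxy]; exact mem_insert_self x S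
    exact (mem_insert.1 hx').resolve_right (mem_filter.1 hx).2.1
  have hinj : Function.Injective e := fun i j h => by rw [← hc i, h, hc j]
  set S₀ : Finset V := (univ.erase l).image e with hS₀
  have hS₀c : #S₀ + 1 = Fintype.card ι := by
    rw [hS₀, card_image_of_injective _ hinj, card_erase_of_mem (mem_univ l), card_univ]; omega
  have hS₀e := card_extensions_slack hu hlow hhigh hV l
  have hS₀d : S₀ ∈ doors := by
    obtain ⟨x, hx⟩ := card_pos.1 (hS₀e ▸ one_pos)
    refine mem_filter.2 ⟨mem_univ _, (mem_filter.1 hx).2.2.mono (subset_insert _ _), hS₀c, ?_⟩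
    rw [hS₀, image_image, show c ∘ e = id from funext hc, image_id]
  have hother : ∀ S ∈ doors.erase S₀, Even #(rooms.bipartiteAbove (fun S T => S ⊆ T) S) := by
    intro S hS
    obtain ⟨hne, hS⟩ := mem_erase.1 hS
    rw [hdoorcard S hS]
    obtain ⟨hSd, hSc, hSi⟩ := (mem_filter.1 hS).2
    -- A door made only of slack elements avoids colour `l`, so it would be `S₀`. A non-slack `v`
    -- makes every `above u S k` nonempty, with witness `e k`.
    have hv : ∃ v ∈ S, v ∉ Set.range e := by
      by_contra! h
      refine hne (eq_of_subset_of_card_le (fun v hv => ?_) (by omega))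
      obtain ⟨k, rfl⟩ := h v hv
      refine mem_image_of_mem e ?_
      rw [← hSi]
      exact mem_image.2 ⟨e k, hv, hc k⟩
    obtain ⟨v, hvS, hv⟩ := hv
    rw [card_extensions_eq_two hu ⟨v, hvS⟩ hSd hSc
      fun k => ⟨e k, fun j hj => ⟨v, hvS, hhigh j k v hj.symm hv⟩⟩]
    exact even_two
  have h1 : Even (∑ S ∈ doors, #(rooms.bipartiteAbove (fun S T => S ⊆ T) S)) := by
    rw [hcount]
    exact even_sum _ hroom
  rw [← add_sum_erase _ _ hS₀d, hdoorcard S₀ hS₀d, hS₀e] at h1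
  exact Nat.not_even_one ((Nat.even_add.1 h1).2 (even_sum _ hother))

/-! ### Colourings of a grid on the simplex -/

/-- A colouring of the grid of mesh `1 / N` on the simplex has a grid point near which every
index with a large coordinate appears as a colour. -/
theorem exists_grid_point {ι : Type*} [Fintype ι] [DecidableEq ι] [Nontrivial ι] (N : ℕ)
    (col : (ι → ℕ) → ι) :
    ∃ t : ι → ℕ, ∑ i, t i = N ∧ ∀ i, Fintype.card ι ≤ t i → ∃ t' : ι → ℕ, ∑ k, t' k = N ∧
      col t' = i ∧ ∀ k, t' k < t k + Fintype.card ι ∧ t k < t' k + Fintype.card ι := by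
  let T : Type _ := piAntidiag (univ : Finset ι) N
  have : Fintype T := inferInstanceAs (Fintype (piAntidiag (univ : Finset ι) N))
  let V : Type _ := T ⊕ ι
  have : Fintype V := inferInstanceAs (Fintype (T ⊕ ι))
  classical
  have hsum : ∀ t : T, ∑ i, t.1 i = N := fun t => (mem_piAntidiag.1 t.2).1
  -- Grid points have heights from `1` to `N + 1`, so `0` and `N + 2` put slack elements strictly
  -- below and above them. The second lexicographic entry breaks ties.
  let h : ι → V → ℕ := fun i => Sum.elim (fun t => t.1 i + 1) fun j => if j = i then 0 else N + 2
  let u : ι → V → ℕ ×ₗ Fin (Fintype.card V) := fun i v => toLex (h i v, Fintype.equivFin V v)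
  have hlt : ∀ i v w, h i v < h i w → u i v < u i w := fun i v w hvw =>
    Prod.Lex.toLex_lt_toLex.2 (Or.inl hvw)
  have hle : ∀ i v w, u i v ≤ u i w → h i v ≤ h i w := fun i v w hvw =>
    le_of_not_gt fun hc => absurd hvw (not_le.2 (hlt i w v hc))
  have hu : ∀ i, Function.Injective (u i) := fun i v w hvw =>
    (Fintype.equivFin V).injective (Prod.ext_iff.1 (toLex.injective hvw)).2
  have hT : ∀ y : ι → ℕ, ∑ i, y i = N → y ∈ piAntidiag (univ : Finset ι) N := fun y hy =>
    mem_piAntidiag.2 ⟨hy, fun _ _ => mem_univ _⟩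
  obtain ⟨i₀⟩ : Nonempty ι := inferInstance
  obtain ⟨S, hS, -, hSc⟩ := exists_colorful (u := u) hu (e := Sum.inr)
    (c := Sum.elim (fun t => col t.1) id)
    (by
      rintro i (t | j) hv <;> apply hlt
      · simp [h]
      · have : j ≠ i := fun hj => hv (hj ▸ rfl)
        simp [h, this])
    (by
      rintro i j (t | k) hj hv <;> apply hlt
      · have := single_le_sum (f := t.1) (fun _ _ => Nat.zero_le _) (mem_univ i)
        rw [hsum] at this
        simp [h, hj]
        omega
      · exact absurd ⟨k, rfl⟩ hv)
    ⟨Sum.inl ⟨Pi.single i₀ N, hT _ (by simp)⟩, by simp⟩ (fun _ => rfl)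
  have hdom : ∀ y : T, ∃ i, Sum.inr i ∉ S ∧ ∀ t : T, Sum.inl t ∈ S → y.1 i ≤ t.1 i := by
    intro y
    obtain ⟨i, hi⟩ := hS (Sum.inl y)
    refine ⟨i, fun hiS => ?_, fun t ht => ?_⟩
    · simpa [h] using hle _ _ _ (hi _ hiS)
    · simpa [h] using hle _ _ _ (hi _ ht)
  have hcol : ∀ i, Sum.inr i ∉ S → ∃ t : T, Sum.inl t ∈ S ∧ col t.1 = i := by
    intro i hi
    obtain ⟨t | j, hv, hvi⟩ := mem_image.1 (hSc ▸ mem_univ i)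
    · exact ⟨t, hv, hvi⟩
    · exact absurd (show j = i from hvi) (by rintro rfl; exact hi hv)
  obtain ⟨t₀, ht₀⟩ : ∃ t : T, Sum.inl t ∈ S := by
    obtain ⟨i, hi, -⟩ := hdom ⟨Pi.single i₀ N, hT _ (by simp)⟩
    obtain ⟨t, ht, -⟩ := hcol i hi
    exact ⟨t, ht⟩
  obtain ⟨i₁, hi₁, -⟩ := hdom t₀
  have hmin : ∀ i, ∃ m : T, Sum.inl m ∈ S ∧ ∀ t : T, Sum.inl t ∈ S → m.1 i ≤ t.1 i := by
    intro i
    obtain ⟨m, hm, hmin⟩ := exists_min_image ({t | Sum.inl t ∈ S} : Finset T) (fun t => t.1 i)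
      ⟨t₀, by simpa using ht₀⟩
    exact ⟨m, by simpa using hm, fun t ht => hmin t (by simpa using ht)⟩
  choose m hmS hm using hmin
  -- The lower corner of the grid points of `S`; a slack element in `S` puts no constraint on its
  -- coordinate.
  let a : ι → ℕ := fun i => if Sum.inr i ∈ S then 0 else (m i).1 i
  have hat : ∀ t : T, Sum.inl t ∈ S → ∀ i, a i ≤ t.1 i := by
    intro t ht i
    by_cases hi : Sum.inr i ∈ S
    · simp [a, hi]
    · simpa [a, hi] using hm i t ht
  -- Otherwise some grid point would exceed the corner in every coordinate without slack, against
  -- dominance. The mass left over is put on `i₁` to reach the sum `N`.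
  have ha : N < ∑ i, a i + Fintype.card ι := by
    by_contra! hN
    let y : ι → ℕ := fun i => if Sum.inr i ∈ S then 0 else a i + 1
    have hyN : ∑ i, y i ≤ N := by
      refine le_trans (sum_le_sum (g := fun i => a i + 1) fun i _ => ?_) (by
        simpa [sum_add_distrib] using hN)
      by_cases hi : Sum.inr i ∈ S <;> simp [y, hi]
    obtain ⟨i, hi, hle⟩ := hdom ⟨y + Pi.single i₁ (N - ∑ i, y i), hT _ (by
      simp [sum_add_distrib, hyN])⟩
    have := hle (m i) (hmS i)
    simp [y, a, hi] at this
    omega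
  have hta : ∀ t : T, Sum.inl t ∈ S → ∀ k, t.1 k < a k + Fintype.card ι := by
    intro t ht k
    have h1 := sum_erase_add univ t.1 (mem_univ k)
    have h2 := sum_erase_add univ a (mem_univ k)
    have h3 := sum_le_sum (s := univ.erase k) fun i _ => hat t ht i
    have h4 := hsum t
    omega
  refine ⟨t₀.1, hsum t₀, fun i hi => ?_⟩
  have hiS : Sum.inr i ∉ S := by
    intro hiS
    have := hta t₀ ht₀ i
    simp only [a, hiS, if_true] at this
    omega
  obtain ⟨t, ht, hti⟩ := hcol i hiS
  refine ⟨t.1, hsum t, hti, fun k => ⟨?_, ?_⟩⟩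
  · exact (hta t ht k).trans_le (Nat.add_le_add_right (hat t₀ ht₀ k) _)
  · exact (hta t₀ ht₀ k).trans_le (Nat.add_le_add_right (hat t ht k) _)

end Scarf

/-! ### Closed covers of the simplex and Ky Fan's inequality -/

open Finset Filter Topology in
/-- A closed cover of the simplex, indexed by its vertices, has a point that lies in every member
of the cover whose barycentric coordinate does not vanish there. -/
theorem stdSimplex.exists_mem_of_pos {ι : Type*} [Fintype ι] [Nonempty ι]
    (F : ι → Set (stdSimplex ℝ ι)) (hF : ∀ i, IsClosed (F i)) (hcover : ∀ z, ∃ i, z ∈ F i) :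
    ∃ z : stdSimplex ℝ ι, ∀ i, 0 < z i → z ∈ F i := by
  classical
  rcases subsingleton_or_nontrivial ι with hι | hι
  · obtain ⟨i⟩ := ‹Nonempty ι›
    obtain ⟨j, hj⟩ := hcover (stdSimplex.vertex i)
    exact ⟨_, fun k _ => Subsingleton.elim j k ▸ hj⟩
  obtain ⟨n, hn, hn0⟩ : ∃ n : ℝ, n = Fintype.card ι ∧ 0 ≤ n := ⟨_, rfl, Nat.cast_nonneg _⟩
  let pt : ∀ (N : ℕ) (t : ι → ℕ), ∑ i, t i = N + 1 → stdSimplex ℝ ι := fun N t ht =>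
    ⟨fun i => t i / ((N : ℝ) + 1), fun i => by positivity, by
      rw [← sum_div, ← Nat.cast_sum, ht, Nat.cast_add_one, div_self (by positivity)]⟩
  have hgrid : ∀ N : ℕ, ∃ z : stdSimplex ℝ ι, ∀ i, n / ((N : ℝ) + 1) ≤ z i →
      ∃ z' ∈ F i, dist z' z ≤ n / ((N : ℝ) + 1) := by
    intro N
    -- Each grid point is coloured by a member of the cover containing it.
    choose f hf using hcover
    obtain ⟨t, ht, h⟩ := Scarf.exists_grid_point (N + 1)
      (fun t : ι → ℕ => if ht : ∑ i, t i = N + 1 then f (pt N t ht) else Classical.arbitrary ι)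
    refine ⟨pt N t ht, fun i hi => ?_⟩
    have hi' : Fintype.card ι ≤ t i := by
      have : n ≤ t i := (div_le_div_iff_of_pos_right (by positivity)).1 hi
      rw [hn] at this; exact_mod_cast this
    obtain ⟨t', ht', hti, hclose⟩ := h i hi'
    rw [dif_pos ht'] at hti
    refine ⟨pt N t' ht', hti ▸ hf _, ?_⟩
    rw [Subtype.dist_eq, dist_pi_le_iff (by positivity)]
    intro k
    have h1 : (t' k : ℝ) < t k + n := by rw [hn]; exact_mod_cast (hclose k).1
    have h2 : (t k : ℝ) < t' k + n := by rw [hn]; exact_mod_cast (hclose k).2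
    change |(t' k : ℝ) / ((N : ℝ) + 1) - t k / ((N : ℝ) + 1)| ≤ _
    rw [← sub_div, abs_div, abs_of_pos (show (0 : ℝ) < (N : ℝ) + 1 by positivity)]
    gcongr
    exact abs_le.2 ⟨by linarith, by linarith⟩
  choose z hz using hgrid
  obtain ⟨w, φ, hφ, hw⟩ := CompactSpace.tendsto_subseq z
  have hmesh : Tendsto (fun k => n / ((φ k : ℝ) + 1)) atTop (𝓝 0) :=
    (tendsto_const_nhds.div_atTop (tendsto_atTop_add_const_right _ 1
      (tendsto_natCast_atTop_atTop.comp hφ.tendsto_atTop)))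
  -- If `w i > 0`, the `i`-th coordinate of `z (φ k)` eventually exceeds the vanishing threshold, so
  -- points of `F i` accumulate at `w`.
  refine ⟨w, fun i hi => ?_⟩
  rw [← (hF i).closure_eq, Metric.mem_closure_iff]
  intro ε hε
  have hcoord : Tendsto (fun k => z (φ k) i) atTop (𝓝 (w i)) :=
    ((continuous_apply i).comp continuous_subtype_val).continuousAt.tendsto.comp hw
  obtain ⟨k, hk1, hk2, hk3⟩ := ((hmesh.eventually_lt hcoord hi).and
    ((hmesh.eventually_lt_const (half_pos hε)).and
      ((tendsto_iff_dist_tendsto_zero.1 hw).eventually_lt_const (half_pos hε)))).exists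
  obtain ⟨z', hz', hd⟩ := hz (φ k) i hk1.le
  refine ⟨z', hz', ?_⟩
  have h1 := dist_triangle w (z (φ k)) z'
  have h2 : dist w (z (φ k)) < ε / 2 := by rw [dist_comm]; exact hk3
  have h3 : dist (z (φ k)) z' < ε / 2 := by rw [dist_comm]; exact hd.trans_lt hk2
  linarith

/-- **Ky Fan's inequality**, for a space `Z` with an abstract operation of taking mixtures. -/
theorem exists_forall_le_zero_of_mixtures {Z : Type*} [TopologicalSpace Z] [CompactSpace Z]
    [Nonempty Z] (f : Z → Z → ℝ) (hf : ∀ y, Continuous fun z => f z y)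
    (hmix : ∀ (s : Finset Z), s.Nonempty → ∃ φ : stdSimplex ℝ s → Z, Continuous φ ∧
      ∀ w, ∑ y : s, w y * f (φ w) y ≤ 0) :
    ∃ z, ∀ y, f z y ≤ 0 := by
  have hfin : (⋂ y, {z | f z y ≤ 0}).Nonempty := by
    refine CompactSpace.iInter_nonempty (fun y => isClosed_le (hf y) continuous_const) fun s => ?_
    rcases s.eq_empty_or_nonempty with rfl | hs
    · simp
    obtain ⟨φ, hφ, hw⟩ := hmix s hs
    have : Nonempty s := hs.to_subtype
    -- The `i`-th set is where `i` attains the largest value. At `w` all indices of positive weight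
    -- attain it, so the maximum is the weighted average, which is at most zero.
    obtain ⟨w, hwF⟩ := stdSimplex.exists_mem_of_pos
      (fun i : s => {w | ∀ j : s, f (φ w) j ≤ f (φ w) i})
      (fun i => by
        simp only [Set.ofPred_forall]
        exact isClosed_iInter fun j => isClosed_le ((hf j).comp hφ) ((hf i).comp hφ))
      (fun w => by
        obtain ⟨i, hi⟩ := Finite.exists_max fun j : s => f (φ w) j
        exact ⟨i, hi⟩)
    refine ⟨φ w, Set.mem_iInter₂.2 fun y hy => ?_⟩
    refine le_trans ?_ (hw w)
    calc f (φ w) y = ∑ i, w i * f (φ w) y := by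
          rw [← Finset.sum_mul, show ∑ i, w i = 1 from w.2.2, one_mul]
      _ ≤ ∑ i, w i * f (φ w) i := by
          refine Finset.sum_le_sum fun i _ => ?_
          rcases (w.2.1 i).eq_or_lt with h0 | hpos
          · simp [show w i = 0 from h0.symm]
          · exact mul_le_mul_of_nonneg_left (hwF i hpos ⟨y, hy⟩) hpos.le
  obtain ⟨z, hz⟩ := hfin
  exact ⟨z, fun y => Set.mem_iInter.1 hz y⟩

theorem continuous_stdSimplex_apply {ι : Type*} [Fintype ι] (i : ι) :
    Continuous fun w : stdSimplex ℝ ι => w i :=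
  (continuous_apply i).comp continuous_subtype_val

namespace BerkNash

/-! ### Continuity of the discounted value -/

section Value

variable {X A : Type*}

theorem measurable_comp_last (t : ℕ) (g : StateAction X A → ℝ) :
    Measurable fun h : Π _ : Finset.Iic t, StateAction X A => g (h ⟨t, Finset.mem_Iic.2 le_rfl⟩) :=
  (Measurable.of_discrete (f := g)).comp (measurable_pi_apply _)

variable [Fintype X] [Fintype A]

instance : Finite (StateAction X A) :=
  Finite.of_injective (fun s => (s.state, s.action)) fun ⟨_, _⟩ ⟨_, _⟩ h => by simpa using h

theorem integral_pairMeasure (π : Policy X A) (ν : stdSimplex ℝ X) (g : StateAction X A → ℝ) :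
    ∫ s, g s ∂(pairMeasure π ν) = ∑ x, ∑ a, ν x * π x a * g ⟨x, a⟩ := by
  have hint : ∀ x a, Integrable g
      (ENNReal.ofReal (ν x * π x a) • Measure.dirac (StateAction.mk x a)) := fun x a =>
    (Integrable.of_finite (μ := Measure.dirac (StateAction.mk x a))).smul_measure
      ENNReal.ofReal_ne_top
  rw [pairMeasure, integral_finsetSum_measure fun x _ =>
    integrable_finsetSum_measure.2 fun a _ => hint x a]
  refine Finset.sum_congr rfl fun x _ => ?_
  rw [integral_finsetSum_measure fun a _ => hint x a]
  refine Finset.sum_congr rfl fun a _ => ?_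
  rw [integral_smul_measure, integral_dirac,
    ENNReal.toReal_ofReal (show 0 ≤ ν x * π x a from mul_nonneg (ν.2.1 x) ((π x).2.1 a)),
    smul_eq_mul]

theorem integral_initialMeasure (π : Policy X A) (x : X) (g : StateAction X A → ℝ) :
    ∫ s, g s ∂(initialMeasure π x) = ∑ a, π x a * g ⟨x, a⟩ := by
  rw [initialMeasure, integral_finsetSum_measure fun a _ =>
    (Integrable.of_finite (μ := Measure.dirac (StateAction.mk x a))).smul_measure
      ENNReal.ofReal_ne_top]
  refine Finset.sum_congr rfl fun a _ => ?_
  rw [integral_smul_measure, integral_dirac,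
    ENNReal.toReal_ofReal (show 0 ≤ π x a from (π x).2.1 a), smul_eq_mul]

instance (K : TransitionKernel X A) (π : Policy X A) (x : X) :
    IsProbabilityMeasure (processLaw K π x) := by
  rw [processLaw]; infer_instance

theorem integrable_comp_eval (K : TransitionKernel X A) (π : Policy X A) (x : X) (t : ℕ)
    (g : StateAction X A → ℝ) : Integrable (fun ω => g (ω t)) (processLaw K π x) := by
  have : IsProbabilityMeasure ((processLaw K π x).map fun ω => ω t) :=
    Measure.isProbabilityMeasure_map (measurable_pi_apply t).aemeasurable
  exact (Integrable.of_finite (f := g)).comp_measurable (measurable_pi_apply t)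

/-- The conditional expectation of `g (x_{t+1}, a_{t+1})` given `(x_t, a_t)`. -/
def nextMean (K : TransitionKernel X A) (π : Policy X A) (g : StateAction X A → ℝ)
    (s : StateAction X A) : ℝ :=
  ∑ x, ∑ a, K s.state s.action x * π x a * g ⟨x, a⟩

theorem integral_eval_succ (K : TransitionKernel X A) (π : Policy X A) (x : X) (t : ℕ)
    (g : StateAction X A → ℝ) :
    ∫ ω, g (ω (t + 1)) ∂(processLaw K π x) = ∫ ω, nextMean K π g (ω t) ∂(processLaw K π x) := by
  have hmap := Kernel.map_frestrictLe_trajMeasure_compProd_eq_map_trajMeasure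
    (X := fun _ => StateAction X A) (μ₀ := initialMeasure π x) (κ := stepKernel K π) (a := t)
  have hmeas : Measurable fun ω : ℕ → StateAction X A =>
      (Preorder.frestrictLe (π := fun _ => StateAction X A) t ω, ω (t + 1)) := by fun_prop
  have hg : Measurable g := Measurable.of_discrete
  have hint : Integrable (fun p : (Π _ : Finset.Iic t, StateAction X A) × StateAction X A => g p.2)
      ((processLaw K π x).map fun ω => (Preorder.frestrictLe t ω, ω (t + 1))) := by
    rw [integrable_map_measure (by fun_prop) hmeas.aemeasurable]
    exact integrable_comp_eval K π x (t + 1) g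
  calc ∫ ω, g (ω (t + 1)) ∂(processLaw K π x)
      = ∫ p, g p.2 ∂((processLaw K π x).map fun ω => (Preorder.frestrictLe t ω, ω (t + 1))) := by
        rw [integral_map hmeas.aemeasurable (by fun_prop)]
    _ = ∫ h, ∫ s, g s ∂(stepKernel K π t h) ∂((processLaw K π x).map (Preorder.frestrictLe t)) := by
        rw [processLaw, ← hmap] at hint ⊢
        exact Measure.integral_compProd hint
    _ = ∫ h, nextMean K π g (h ⟨t, Finset.mem_Iic.2 le_rfl⟩)
          ∂((processLaw K π x).map (Preorder.frestrictLe t)) := by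
        refine integral_congr_ae (.of_forall fun h => ?_)
        exact integral_pairMeasure _ _ _
    _ = _ := by
        have : Measurable (nextMean K π g) := Measurable.of_discrete
        rw [integral_map (by fun_prop)
          (measurable_comp_last t _).aestronglyMeasurable]
        rfl

theorem integral_eval_zero (K : TransitionKernel X A) (π : Policy X A) (x : X)
    (g : StateAction X A → ℝ) :
    ∫ ω, g (ω 0) ∂(processLaw K π x) = ∑ a, π x a * g ⟨x, a⟩ := by
  have hg : Measurable g := Measurable.of_discrete
  have hmap : (processLaw K π x).map (Preorder.frestrictLe 0) = (initialMeasure π x).map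
      (MeasurableEquiv.piUnique fun _ : Finset.Iic 0 => StateAction X A).symm := by
    rw [processLaw, Kernel.trajMeasure, Measure.map_comp _ _ (by fun_prop),
      Kernel.traj_map_frestrictLe, Kernel.partialTraj_self, Measure.id_comp]
  calc ∫ ω, g (ω 0) ∂(processLaw K π x)
      = ∫ h, g (h ⟨0, Finset.mem_Iic.2 le_rfl⟩)
          ∂((processLaw K π x).map (Preorder.frestrictLe 0)) := by
        rw [integral_map (by fun_prop) (measurable_comp_last 0 g).aestronglyMeasurable]
        rfl
    _ = _ := by
        rw [hmap, integral_map (by fun_prop)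
          (measurable_comp_last 0 g).aestronglyMeasurable, ← integral_initialMeasure]
        rfl

/-- This turns expectations under the trajectory law into finite sums of products of kernel and
policy entries, where continuity is visible. -/
theorem integral_eval (K : TransitionKernel X A) (π : Policy X A) (x : X) (t : ℕ)
    (g : StateAction X A → ℝ) :
    ∫ ω, g (ω t) ∂(processLaw K π x) = ∑ a, π x a * (nextMean K π)^[t] g ⟨x, a⟩ := by
  induction t generalizing g with
  | zero => exact integral_eval_zero K π x g
  | succ t ih => rw [integral_eval_succ, ih, Function.iterate_succ_apply]

theorem continuous_iterate_nextMean (g : StateAction X A → ℝ) (t : ℕ) (s : StateAction X A) :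
    Continuous fun p : TransitionKernel X A × Policy X A => (nextMean p.1 p.2)^[t] g s := by
  induction t generalizing s with
  | zero => exact continuous_const
  | succ t ih =>
    simp only [Function.iterate_succ_apply', nextMean]
    refine continuous_finsetSum _ fun x _ => continuous_finsetSum _ fun a _ => ?_
    refine Continuous.mul (Continuous.mul ?_ ?_) (ih _)
    · exact (continuous_stdSimplex_apply x).comp
        ((continuous_apply_apply s.state s.action).comp continuous_fst)
    · exact (continuous_stdSimplex_apply a).comp ((continuous_apply x).comp continuous_snd)

/-- The Weierstrass test: the `t`-th expected term is continuous and bounded by `β ^ t * C`,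
uniformly in kernel and policy. -/
theorem continuous_value (r : X → A → ℝ) {β : ℝ} (hβ0 : 0 ≤ β) (hβ1 : β < 1) (x : X) :
    Continuous fun p : TransitionKernel X A × Policy X A => value p.1 r β p.2 x := by
  let g : StateAction X A → ℝ := fun s => r s.state s.action
  obtain ⟨C, hC⟩ : ∃ C, ∀ s, ‖g s‖ ≤ C := by
    obtain ⟨C, hC⟩ := (Set.finite_range fun s => ‖g s‖).bddAbove
    exact ⟨C, fun s => hC ⟨s, rfl⟩⟩
  have hbound : ∀ (p : TransitionKernel X A × Policy X A) t,
      ‖∫ ω, β ^ t * g (ω t) ∂(processLaw p.1 p.2 x)‖ ≤ β ^ t * C := by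
    intro p t
    refine (norm_integral_le_of_norm_le_const (C := β ^ t * C) (.of_forall fun ω => ?_)).trans
      (by simp)
    rw [norm_mul, norm_pow, Real.norm_of_nonneg hβ0]
    exact mul_le_mul_of_nonneg_left (hC _) (pow_nonneg hβ0 t)
  have hsummable : Summable fun t => β ^ t * C :=
    (summable_geometric_of_lt_one hβ0 hβ1).mul_right C
  have hvalue : ∀ p : TransitionKernel X A × Policy X A,
      value p.1 r β p.2 x = ∑' t, ∫ ω, β ^ t * g (ω t) ∂(processLaw p.1 p.2 x) := by
    intro p
    refine (integral_tsum_of_summable_integral_norm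
      (fun t => (integrable_comp_eval p.1 p.2 x t g).const_mul _) ?_).symm
    refine hsummable.of_nonneg_of_le (fun t => integral_nonneg fun ω => norm_nonneg _) fun t => ?_
    refine (integral_mono_of_nonneg (.of_forall fun ω => norm_nonneg _)
      (integrable_const (β ^ t * C)) (.of_forall fun ω => ?_)).trans (by simp)
    simp only [norm_mul, norm_pow, Real.norm_of_nonneg hβ0]
    exact mul_le_mul_of_nonneg_left (hC _) (pow_nonneg hβ0 t)
  simp_rw [hvalue]
  refine continuous_tsum (fun t => ?_) hsummable fun t p => hbound p t
  simp_rw [integral_const_mul, integral_eval]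
  refine continuous_const.mul (continuous_finsetSum _ fun a _ => ?_)
  exact ((continuous_stdSimplex_apply a).comp ((continuous_apply x).comp continuous_snd)).mul
    (continuous_iterate_nextMean g t ⟨x, a⟩)

/-- A supremum of a jointly continuous function over the compact policy space is continuous. -/
theorem continuous_optimalValue (r : X → A → ℝ) {β : ℝ} (hβ0 : 0 ≤ β) (hβ1 : β < 1) (x : X) :
    Continuous fun K : TransitionKernel X A => optimalValue K r β x := by
  simpa only [Set.image_univ, optimalValue, iSup] using
    (isCompact_univ (X := Policy X A)).continuous_sSup (continuous_value r hβ0 hβ1 x)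

theorem continuous_actionValue (r : X → A → ℝ) {β : ℝ} (hβ0 : 0 ≤ β) (hβ1 : β < 1) (x : X)
    (a : A) : Continuous fun K : TransitionKernel X A => actionValue K r β x a :=
  continuous_const.add <| continuous_const.mul <| continuous_finsetSum _ fun x' _ =>
    ((continuous_stdSimplex_apply x').comp (continuous_apply_apply x a)).mul
      (continuous_optimalValue r hβ0 hβ1 x')

end Value

/-! ### Existence of a solution -/

section Existence

variable {X A : Type*} [Fintype A]

/-- The mixture of the policies `p i` with weights `w i`. -/
def mixPolicy {ι : Type*} [Fintype ι] (p : ι → Policy X A) (w : stdSimplex ℝ ι) : Policy X A :=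
  fun x => ⟨fun a => ∑ i, w i * p i x a,
    fun a => Finset.sum_nonneg fun i _ => mul_nonneg (w.2.1 i) ((p i x).2.1 a), by
      rw [Finset.sum_comm]
      simp_rw [← Finset.mul_sum]
      exact (Finset.sum_congr rfl fun i _ => by
        rw [show ∑ a, p i x a = 1 from (p i x).2.2, mul_one]; rfl).trans w.2.2⟩

theorem continuous_mixPolicy {ι : Type*} [Fintype ι] (p : ι → Policy X A) :
    Continuous (mixPolicy p) :=
  continuous_pi fun _ => Continuous.subtype_mk (continuous_pi fun _ =>
    continuous_finsetSum _ fun i _ => (continuous_stdSimplex_apply i).mul continuous_const) _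

variable [Fintype X]

/-- The total of the action values `q` under the policy `π`, over all states. -/
def totalValue (q : X → A → ℝ) (π : Policy X A) : ℝ :=
  ∑ x, ∑ a, π x a * q x a

theorem totalValue_mixPolicy {ι : Type*} [Fintype ι] (q : X → A → ℝ) (p : ι → Policy X A)
    (w : stdSimplex ℝ ι) : totalValue q (mixPolicy p w) = ∑ i, w i * totalValue q (p i) := by
  have h : ∀ x a, mixPolicy p w x a = ∑ i, w i * p i x a := fun _ _ => rfl
  simp only [totalValue, h, Finset.mul_sum, Finset.sum_mul]
  rw [Finset.sum_congr rfl fun x _ => Finset.sum_comm, Finset.sum_comm]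
  simp only [mul_assoc]

/-- A policy that maximizes the total of the action values plays only maximizing actions. -/
theorem le_of_totalValue_le {q : X → A → ℝ} {π : Policy X A}
    (h : ∀ π', totalValue q π' ≤ totalValue q π) {x : X} {a : A} (ha : 0 < π x a) (b : A) :
    q x b ≤ q x a := by
  classical
  by_contra! hlt
  have hne : a ≠ b := by rintro rfl; exact lt_irrefl _ hlt
  -- All mass of `a` at `x` is moved to `b`, which raises the total by `π x a * (q x b - q x a)`.
  let ρ : A → ℝ := fun c => π x c + (if c = b then π x a else 0) - if c = a then π x a else 0
  have hρ : ρ ∈ stdSimplex ℝ A := by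
    refine ⟨fun c => ?_, ?_⟩
    · have h1 : 0 ≤ π x c := (π x).2.1 c
      by_cases hca : c = a
      · subst hca; simp [ρ, hne]
      · by_cases hcb : c = b
        · subst hcb; simp [ρ, hca]; linarith
        · simp [ρ, hca, hcb]
    · simp [ρ, Finset.sum_add_distrib]
  have h1 := h (Function.update π x ⟨ρ, hρ⟩)
  have h2 : ∀ y, y ≠ x → ∑ c, Function.update π x ⟨ρ, hρ⟩ y c * q y c = ∑ c, π y c * q y c :=
    fun y hy => by rw [Function.update_of_ne hy]
  have h3 : ∑ c, Function.update π x ⟨ρ, hρ⟩ x c * q x c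
      = ∑ c, π x c * q x c + π x a * (q x b - q x a) := by
    rw [Function.update_self]
    change ∑ c, ρ c * q x c = _
    simp only [ρ, sub_mul, add_mul, ite_mul, zero_mul, Finset.sum_sub_distrib,
      Finset.sum_add_distrib, Finset.sum_ite_eq', Finset.mem_univ, if_true]
    ring
  simp only [totalValue] at h1
  rw [← Finset.add_sum_erase _ _ (Finset.mem_univ x), h3,
    Finset.sum_congr rfl fun y hy => h2 y (Finset.ne_of_mem_erase hy),
    ← Finset.add_sum_erase _ (fun y => ∑ c, π y c * q y c) (Finset.mem_univ x)] at h1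
  have := mul_pos ha (sub_pos.2 hlt)
  linarith

/-- A game between an agent with a linear payoff, given by the action values `q θ`, and an
opponent with convex losses `D · π` has an equilibrium. -/
theorem exists_equilibrium [Nonempty A] {E : Type*} [AddCommGroup E] [Module ℝ E]
    [TopologicalSpace E] [IsTopologicalAddGroup E] [ContinuousSMul ℝ E] {Θ : Set E}
    (hne : Θ.Nonempty) (hcompact : IsCompact Θ) (hconvex : Convex ℝ Θ) {q : E → X → A → ℝ}
    (hq : ∀ x a, ContinuousOn (fun θ => q θ x a) Θ) {D : E → Policy X A → ℝ}
    (hD : ContinuousOn (fun p : E × Policy X A => D p.1 p.2) (Θ ×ˢ Set.univ))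
    (hDconvex : ∀ π, ConvexOn ℝ Θ fun θ => D θ π) :
    ∃ π : Policy X A, ∃ θ ∈ Θ, (∀ π', totalValue (q θ) π' ≤ totalValue (q θ) π) ∧
      ∀ θ' ∈ Θ, D θ π ≤ D θ' π := by
  have : CompactSpace Θ := isCompact_iff_compactSpace.1 hcompact
  have : Nonempty Θ := hne.to_subtype
  -- The Nikaido–Isoda function: the sum of both players' gains from unilateral deviations.
  let f : Policy X A × Θ → Policy X A × Θ → ℝ := fun z y =>
    totalValue (q z.2) y.1 - totalValue (q z.2) z.1 + (D z.2 z.1 - D y.2 z.1)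
  have hq' : ∀ x a, Continuous fun z : Policy X A × Θ => q z.2 x a := fun x a =>
    (continuousOn_iff_continuous_domRestrict.1 (hq x a)).comp continuous_snd
  have hD' : ∀ g : Policy X A × Θ → Θ, Continuous g →
      Continuous fun z : Policy X A × Θ => D (g z) z.1 := fun g hg =>
    hD.comp_continuous ((continuous_subtype_val.comp hg).prodMk continuous_fst)
      fun z => ⟨(g z).2, trivial⟩
  obtain ⟨⟨π, θ⟩, h⟩ := exists_forall_le_zero_of_mixtures f
    (fun y => by
      refine ((continuous_finsetSum _ fun x _ => continuous_finsetSum _ fun a _ => ?_).sub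
        (continuous_finsetSum _ fun x _ => continuous_finsetSum _ fun a _ => ?_)).add
        ((hD' _ continuous_snd).sub (hD' _ continuous_const))
      · exact continuous_const.mul (hq' x a)
      · exact ((continuous_stdSimplex_apply a).comp ((continuous_apply x).comp
          continuous_fst)).mul (hq' x a))
    (fun s _ => by
      let mixΘ : stdSimplex ℝ s → Θ := fun w => ⟨∑ i : s, w i • (i.1.2 : E),
        hconvex.sum_mem (fun i _ => w.2.1 i) w.2.2 fun i _ => i.1.2.2⟩
      have hmixΘ : Continuous mixΘ := Continuous.subtype_mk (continuous_finsetSum _ fun i _ =>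
        (continuous_stdSimplex_apply i).smul continuous_const) _
      refine ⟨fun w => (mixPolicy (fun i : s => i.1.1) w, mixΘ w),
        (continuous_mixPolicy _).prodMk hmixΘ, fun w => ?_⟩
      have hw : ∑ i, w i = 1 := w.2.2
      have hjensen : D (mixΘ w) (mixPolicy (fun i : s => i.1.1) w) ≤
          ∑ i : s, w i * D i.1.2 (mixPolicy (fun i : s => i.1.1) w) :=
        (hDconvex _).map_sum_le (fun i _ => w.2.1 i) w.2.2 fun i _ => i.1.2.2
      -- The agent's weighted gains cancel by linearity; the opponent's are nonpositive by Jensen.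
      simp only [f, mul_add, mul_sub, Finset.sum_add_distrib, Finset.sum_sub_distrib,
        ← Finset.sum_mul, hw, one_mul, totalValue_mixPolicy]
      linarith)
  -- Changing only one component of `y` isolates one player's gain.
  refine ⟨π, θ, θ.2, fun π' => ?_, fun θ' hθ' => ?_⟩
  · have := h (π', θ)
    simp only [f] at this
    linarith
  · have := h (π, ⟨θ', hθ'⟩)
    simp only [f] at this
    linarith

end Existence

end BerkNash

theorem mainTheorem1 {X A : Type*} [Fintype X] [DecidableEq X] [Nonempty X]
    [Fintype A] [Nonempty A] {k : ℕ}
    -- the true kernel, the reward, the discount factor, the parameter set, the subjective kernels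
    (P : BerkNash.TransitionKernel X A) (r : X → A → ℝ) (β : ℝ)
    (Θ : Set (EuclideanSpace ℝ (Fin k)))
    (Q : EuclideanSpace ℝ (Fin k) → BerkNash.TransitionKernel X A)
    -- primitives and continuity
    (hβ0 : 0 < β) (hβ1 : β < 1)
    (hΘ_nonempty : Θ.Nonempty) (hΘ_compact : IsCompact Θ) (hΘ_convex : Convex ℝ Θ)
    (hQ_cont : ∀ x a x', ContinuousOn (fun θ => Q θ x a x') Θ)
    -- ergodicity and continuity of stationary distributions
    (h_irred : ∀ π : BerkNash.Policy X A, (BerkNash.inducedMatrix P π).IsIrreducible)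
    (h_aper : ∀ π : BerkNash.Policy X A, BerkNash.IsAperiodic (BerkNash.inducedMatrix P π))
    (h_stat_cont : Continuous fun π : BerkNash.Policy X A => BerkNash.stationaryDist P π)
    -- well-behaved Kullback-Leibler functional
    (h_ac : ∀ θ ∈ Θ, ∀ x a x', Q θ x a x' = 0 → P x a x' = 0)
    (hD_cont : ContinuousOn
      (fun p : EuclideanSpace ℝ (Fin k) × BerkNash.Policy X A => BerkNash.longRunKL P Q p.1 p.2)
      (Θ ×ˢ Set.univ))
    (hD_convex : ∀ π : BerkNash.Policy X A,
      ConvexOn ℝ Θ fun θ => BerkNash.longRunKL P Q θ π) :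
    ∃ π : BerkNash.Policy X A, ∃ θ ∈ Θ, BerkNash.IsSolution P Q Θ r β π θ := by

  have hQ : ContinuousOn Q Θ := continuousOn_pi.2 fun x => continuousOn_pi.2 fun a =>
    continuousOn_iff_continuous_domRestrict.2 <| Continuous.subtype_mk (continuous_pi fun x' =>
      continuousOn_iff_continuous_domRestrict.1 (hQ_cont x a x')) fun θ => (Q θ x a).2
  obtain ⟨π, θ, hθ, hπ, hD⟩ := BerkNash.exists_equilibrium hΘ_nonempty hΘ_compact hΘ_convex
    (q := fun θ => BerkNash.actionValue (Q θ) r β)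
    (fun x a => (BerkNash.continuous_actionValue r hβ0.le hβ1 x a).comp_continuousOn hQ)
    hD_cont hD_convex
  exact ⟨π, θ, hθ, fun x a ha b => BerkNash.le_of_totalValue_le hπ ha b, hθ, hD⟩
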